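/- Let $K$ be a totally imaginary number field of degree $n$ over $\mathbb{Q}$, let $\mathcal{O}_K$ be its ring of integers, and let $\Sigma$ be the set of its $n$ field embeddings $\sigma : K \hookrightarrow \mathbb{C}$. Let $\mathbf{r} = (r_\sigma)_{\sigma\in\Sigma}$ be a real weight vector with $r_\sigma \ge 0$ for all $\sigma$ and $\sum_{\sigma\in\Sigma} r_\sigma = 1$. Put $\Sigma_+ = \{\sigma : r_\sigma > 0\}$, $\Sigma_0 = \{\sigma : r_\sigma = 0\}$, and $\|q\|_{\mathbf{r}} = \max_{\sigma\in\Sigma_+} |\sigma(q)|^{1/r_\sigma}$ for $q \in K$. Let $\mathbf{Bad}(K,\mathbf{r})$ be the set of all $\mathbf{z} = (z_\sigma)_{\sigma\in\Sigma} \in \prod_{\sigma\in\Sigma}\mathbb{C} = \mathbb{C}^n$ such that $$\inf_{p\in\mathcal{O}_K,\ q\in\mathcal{O}_K\setminus\{0\}} \max\Big\{ \max_{\sigma\in\Sigma_+} \|q\|_{\mathbf{r}}^{r_\sigma}\,|\sigma(q)z_\sigma + \sigma(p)|,\ \max_{\sigma\in\Sigma_0} \max\{|\sigma(q)z_\sigma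 + \sigma(p)|,\ |\sigma(q)|\} \Big\} > 0,$$ where the maximum over $\Sigma_0$ is omitted if $\Sigma_0$ is empty. For $0<\beta<\frac13$, the $\beta$-hyperplane-absolute game on $\mathbb{C}^n$ (with the Euclidean norm) is played as follows. Player B begins with a closed ball $B_0$ of radius $\rho_0 > 0$. For each $j \ge 0$, once B has chosen the closed ball $B_j$ of radius $\rho_j$, Player A chooses a complex affine hyperplane $\mathcal{H}_j$ (an affine subspace of complex dimension $n-1$) and a number $0<\delta_j \le \beta\rho_j$; then B chooses a closed ball $B_{j+1} \subset B_j \setminus \mathcal{H}_j^{(\delta_j)}$ of radius $\rho_{j+1} \ge \beta\rho_j$, where $\mathcal{H}^{(\delta)} = \{\mathbf{z}\in\mathbb{C}^n : \inf_{\mathbf{w}\in\mathcal{H}} \|\mathbf{z}-\mathbf{w}\| < \delta\}$. A set $E\subset\mathbb{C}^n$ is $\beta$-hyperplane-absolute-winning if A has a strategy which guarantees that $E\cap\bigcap_{j\ge0} B_j \neq \emptyset$ whatever moves B makes, and $E$ is hyperplane-absolute-winning (HAW) if it is $\beta$-hyperplane-absolute-winning for every $0<\beta<\frac13$. Then $\mathbf{Bad}(K,\mathbf{r})$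 is hyperplane-absolute-winning in $\mathbb{C}^n$. -/

import Mathlib

noncomputable section

namespace WeightedBad

/-! ### The hyperplane-absolute game on a complex normed space -/

section Game

variable (E : Type*) [NormedAddCommGroup E] [NormedSpace ℂ E]

/-- A move of Player B: a closed ball, given by its centre and its positive radius. -/
structure Ball where
  center : E
  radius : ℝ
  radius_pos : 0 < radius

/-- A complex affine hyperplane: a nonempty complex affine subspace of complex codimension one. -/
def IsHyperplane (H : AffineSubspace ℂ E) : Prop :=
  (H : Set E).Nonempty ∧ Module.finrank ℂ H.direction + 1 = Module.finrank ℂ E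

/-- A move of Player A: a hyperplane together with the positive width of its neighbourhood. -/
structure HyperplaneNhd where
  plane : AffineSubspace ℂ E
  isHyperplane : IsHyperplane E plane
  width : ℝ
  width_pos : 0 < width

variable {E}

/-- The closed ball as a set of points. -/
def Ball.toSet (B : Ball E) : Set E := Metric.closedBall B.center B.radius

/-- The open neighbourhood of the hyperplane, i.e. the points at distance less than the width. -/
def HyperplaneNhd.toSet (N : HyperplaneNhd E) : Set E :=
  Metric.thickening N.width (N.plane : Set E)

variable (E) in
/-- A strategy of Player A: a move of A for each history `B₀, …, B_j` of moves of Player B. -/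
abbrev Strategy := (j : ℕ) → (Fin (j + 1) → Ball E) → HyperplaneNhd E

/-- The strategy always answers the ball `B_j` with a hyperplane neighbourhood of width at most
`β` times the radius of `B_j`. -/
def Strategy.IsLegal (β : ℝ) (S : Strategy E) : Prop :=
  ∀ (j : ℕ) (h : Fin (j + 1) → Ball E), (S j h).width ≤ β * (h (Fin.last j)).radius

/-- The infinite sequence `B` of moves of Player B obeys the rules of the `β`-game when Player A
follows the strategy `S`. -/
def IsPlay (β : ℝ) (S : Strategy E) (B : ℕ → Ball E) : Prop :=
  ∀ j : ℕ,
    (B (j + 1)).toSet ⊆ (B j).toSet \ (S j fun i : Fin (j + 1) => B i).toSet ∧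
      β * (B j).radius ≤ (B (j + 1)).radius

/-- `A` is `β`-hyperplane-absolute-winning: Player A has a legal strategy such that in every play
the intersection of the balls chosen by Player B meets `A`. -/
def IsBetaHAW (β : ℝ) (A : Set E) : Prop :=
  ∃ S : Strategy E, S.IsLegal β ∧
    ∀ B : ℕ → Ball E, IsPlay β S B → (A ∩ ⋂ j, (B j).toSet).Nonempty

/-- `A` is hyperplane-absolute-winning. -/
def IsHAW (A : Set E) : Prop :=
  ∀ β : ℝ, 0 < β → β < 1 / 3 → IsBetaHAW β A

end Game

/-! ### Weighted badly approximable complex vectors -/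

section Bad

open NumberField

variable {K : Type*} [Field K] [NumberField K]

/-- The `r`-norm of an element of `K`: the maximum of `|σ(q)| ^ (1 / r_σ)` over the embeddings
`σ` of positive weight. -/
def rNorm (r : (K →+* ℂ) → ℝ) (q : K) : ℝ :=
  ⨆ σ : {σ : K →+* ℂ // 0 < r σ}, ‖σ.1 q‖ ^ (1 / r σ.1)

/-- The quantity whose infimum over `p` and `q ≠ 0` decides whether `z` is badly approximable. The
suprema are maxima over finite index sets of nonnegative numbers; if no weight is zero, then the
second one is over the empty set and has the value `0`. -/
def approxQuality (r : (K →+* ℂ) → ℝ) (z : EuclideanSpace ℂ (K →+* ℂ)) (p q : 𝓞 K) : ℝ :=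
  max
    (⨆ σ : {σ : K →+* ℂ // 0 < r σ},
      rNorm r (q : K) ^ r σ.1 * ‖σ.1 (q : K) * z σ.1 + σ.1 (p : K)‖)
    (⨆ σ : {σ : K →+* ℂ // r σ = 0},
      max ‖σ.1 (q : K) * z σ.1 + σ.1 (p : K)‖ ‖σ.1 (q : K)‖)

variable (K) in
/-- The set of `(K, r)`-badly approximable vectors, inside `ℂⁿ` with coordinates indexed by the
`n = [K : ℚ]` embeddings of `K` into `ℂ`. -/
def Bad (r : (K →+* ℂ) → ℝ) : Set (EuclideanSpace ℂ (K →+* ℂ)) :=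
  {z | 0 < ⨅ pq : 𝓞 K × {q : 𝓞 K // q ≠ 0}, approxQuality r z pq.1 pq.2.1}

end Bad

end WeightedBad

end

noncomputable section

namespace WeightedBad

open Metric Filter Topology NumberField

/-! ### Containment of closed balls -/

section Containment

variable {E : Type*} [NormedAddCommGroup E] [NormedSpace ℂ E]

/-! If `z` is not in `Bad K r`, then for each `c > 0` some pair `(p, q)` has quality below `c`. Put
Q = ‖q‖_r ~ 2^a and let 2^b be the size of max_σ |σ(q)| Q^{r_σ}, attained at σ; such `z` form an
`obstacle`. For every σ' of positive weight, |σ'(q)| is at most about 2^m with m = min(a r_σ', b - a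
r_σ'), and 2m = b - |2 a r_σ' - b| ≤ b - s, where s is the least of these absolute values. Hence for
two such pairs with points in one ball of radius at most 2^(s-b-5), every conjugate of qp' - q'p is
below 1 in modulus, so this algebraic integer vanishes (`norm_det_lt_one`). All pairs then share one
fraction, and the obstacle lies within c 2^(-b) of a single coordinate hyperplane z_σ = x
(`exists_center_of_obstacle`).

The gain 2^s in the radius makes the weights (c 2^(-b))^γ of the obstacles living at scale ρ sum to
O(c^γ ρ^γ), for any γ > 0. A potential argument (`exists_potential_criterion`) then wins the game
once c is small: by pigeonhole A deletes a fixed fraction 1/N of the total weight near the current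
ball, which pays for both the shrinking of the ball and the newly active obstacles. -/

lemma dist_add_le_of_closedBall_subset [Nontrivial E] {x y : E} {s t : ℝ} (hs : 0 ≤ s)
    (h : closedBall x s ⊆ closedBall y t) : dist x y + s ≤ t := by
  -- A unit vector pointing from `y` to `x`; moving from `x` by `s` along it reaches the point of
  -- the small ball farthest from `y`. If `x = y`, any direction serves.
  obtain ⟨u, hu, hxu⟩ : ∃ u : E, ‖u‖ = 1 ∧ x - y = ((‖x - y‖ : ℝ) : ℂ) • u := by
    by_cases hxy : x - y = 0
    · obtain ⟨v, hv⟩ := exists_ne (0 : E)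
      have hv' : ‖v‖ ≠ 0 := norm_ne_zero_iff.mpr hv
      refine ⟨((‖v‖⁻¹ : ℝ) : ℂ) • v, ?_, by simp [hxy]⟩
      rw [norm_smul, Complex.norm_real, norm_inv, norm_norm, inv_mul_cancel₀ hv']
    · have hv' : ‖x - y‖ ≠ 0 := norm_ne_zero_iff.mpr hxy
      refine ⟨((‖x - y‖⁻¹ : ℝ) : ℂ) • (x - y), ?_, ?_⟩
      · rw [norm_smul, Complex.norm_real, norm_inv, norm_norm, inv_mul_cancel₀ hv']
      · rw [smul_smul, ← Complex.ofReal_mul, mul_inv_cancel₀ hv', Complex.ofReal_one, one_smul]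
  have hmem : x + (s : ℂ) • u ∈ closedBall y t := h <| by
    rw [mem_closedBall, dist_eq_norm, add_sub_cancel_left, norm_smul, hu, Complex.norm_real,
      Real.norm_of_nonneg hs, mul_one]
  have heq : x + (s : ℂ) • u - y = ((‖x - y‖ + s : ℝ) : ℂ) • u := by
    have : x + (s : ℂ) • u - y = (x - y) + (s : ℂ) • u := by abel
    rw [this, Complex.ofReal_add, add_smul, ← hxu]
  rw [mem_closedBall, dist_eq_norm, heq, norm_smul, hu, Complex.norm_real,
    Real.norm_of_nonneg (by positivity), mul_one] at hmem
  rwa [dist_eq_norm]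

lemma Ball.radius_le_of_subset [Nontrivial E] {B B' : Ball E} (h : B'.toSet ⊆ B.toSet) :
    B'.radius ≤ B.radius := by
  have := dist_add_le_of_closedBall_subset B'.radius_pos.le h
  linarith [dist_nonneg (x := B'.center) (y := B.center)]

omit [NormedSpace ℂ E] in
lemma Ball.toSet_antitone {B : ℕ → Ball E} (h : ∀ j, (B (j + 1)).toSet ⊆ (B j).toSet) :
    Antitone fun j => (B j).toSet :=
  antitone_nat_of_succ_le h

/-- A decreasing sequence of closed balls whose radii do not tend to zero has a common ball. -/
lemma Ball.exists_subset_of_not_tendsto [Nontrivial E] {B : ℕ → Ball E}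
    (h : ∀ j, (B (j + 1)).toSet ⊆ (B j).toSet)
    (hlim : ¬ Tendsto (fun j => (B j).radius) atTop (𝓝 0)) :
    ∃ B' : Ball E, ∀ j, B'.toSet ⊆ (B j).toSet := by
  have hanti : Antitone fun j => (B j).radius :=
    antitone_nat_of_succ_le fun j => Ball.radius_le_of_subset (h j)
  have hbdd : BddBelow (Set.range fun j => (B j).radius) :=
    ⟨0, by rintro _ ⟨j, rfl⟩; exact (B j).radius_pos.le⟩
  have hl := tendsto_atTop_ciInf hanti hbdd
  set ρ := ⨅ j, (B j).radius with hρ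
  have hle : ∀ j, ρ ≤ (B j).radius := fun j => ciInf_le hbdd j
  have hpos : 0 < ρ := by
    have hnonneg : 0 ≤ ρ := le_ciInf fun j => (B j).radius_pos.le
    rcases hnonneg.lt_or_eq with h0 | h0
    · exact h0
    · rw [← h0] at hl
      exact absurd hl hlim
  -- With the radius of `B J` below 3ρ/2, every later centre is within ρ/2 of that of `B J`, so the
  -- ball of radius ρ/2 there fits into all later balls.
  obtain ⟨J, hJ⟩ := (hl.eventually (gt_mem_nhds (show ρ < 3 / 2 * ρ by linarith))).exists
  have hset := Ball.toSet_antitone h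
  refine ⟨⟨(B J).center, ρ / 2, by positivity⟩, fun j => ?_⟩
  rcases le_total j J with hj | hj
  · have := hle J
    exact (closedBall_subset_closedBall (by change ρ / 2 ≤ _; linarith)).trans (hset hj)
  · have hd := dist_add_le_of_closedBall_subset (B j).radius_pos.le (hset hj)
    refine closedBall_subset_closedBall' ?_
    have := hle j
    rw [dist_comm]
    linarith

end Containment

/-! ### Neighbourhoods of coordinate hyperplanes -/

section Coordinate

variable {ι : Type*} [Fintype ι]

/-- The neighbourhood of width `δ` of the coordinate hyperplane `z i = y`. -/
def coordNhd (i : ι) (y : ℂ) (δ : ℝ) (hδ : 0 < δ) : HyperplaneNhd (EuclideanSpace ℂ ι) := by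
  classical
  exact
  { plane := AffineSubspace.mk' (EuclideanSpace.single i y)
      (LinearMap.ker (EuclideanSpace.proj (𝕜 := ℂ) (ι := ι) i).toLinearMap)
    isHyperplane := by
      refine ⟨⟨EuclideanSpace.single i y, AffineSubspace.self_mem_mk' _ _⟩, ?_⟩
      rw [AffineSubspace.direction_mk', add_comm]
      have hr : LinearMap.range (EuclideanSpace.proj (𝕜 := ℂ) (ι := ι) i).toLinearMap = ⊤ := by
        rw [LinearMap.range_eq_top]
        exact fun x => ⟨EuclideanSpace.single i x, by simp⟩
      have := LinearMap.finrank_range_add_finrank_ker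
        (EuclideanSpace.proj (𝕜 := ℂ) (ι := ι) i).toLinearMap
      rw [hr, finrank_top, Module.finrank_self] at this
      exact this
    width := δ
    width_pos := hδ }

lemma mem_coordNhd_plane {i : ι} {y : ℂ} {δ : ℝ} {hδ : 0 < δ} {z : EuclideanSpace ℂ ι} :
    z ∈ (coordNhd i y δ hδ).plane ↔ z i = y := by
  classical
  simp [coordNhd, AffineSubspace.mem_mk', sub_eq_zero]

lemma mem_coordNhd {i : ι} {y : ℂ} {δ : ℝ} {hδ : 0 < δ} {z : EuclideanSpace ℂ ι} :
    z ∈ (coordNhd i y δ hδ).toSet ↔ ‖z i - y‖ < δ := by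
  classical
  unfold HyperplaneNhd.toSet
  rw [mem_thickening_iff]
  constructor
  · rintro ⟨w, hw, hd⟩
    rw [SetLike.mem_coe, mem_coordNhd_plane] at hw
    rw [dist_eq_norm] at hd
    have := PiLp.norm_apply_le (z - w) i
    rw [PiLp.sub_apply, hw] at this
    exact this.trans_lt hd
  · intro h
    refine ⟨z - EuclideanSpace.single i (z i - y), ?_, ?_⟩
    · rw [SetLike.mem_coe, mem_coordNhd_plane]
      simp
    · rw [dist_eq_norm, sub_sub_cancel, PiLp.norm_single]
      exact h

/-- Player B can always answer a coordinate hyperplane with a ball of the smallest radius. -/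
lemma exists_ball_diff_coordNhd {β : ℝ} (hβ : 0 < β) (hβ' : β < 1 / 3)
    (B : Ball (EuclideanSpace ℂ ι)) (i : ι) (y : ℂ) (h : 0 < β * B.radius) :
    ∃ B' : Ball (EuclideanSpace ℂ ι), B'.radius = β * B.radius ∧
      B'.toSet ⊆ B.toSet \ (coordNhd i y (β * B.radius) h).toSet := by
  classical
  have hρ := B.radius_pos
  -- The two shifts by ±(1 - β)ρ along coordinate `i` are 2(1 - β)ρ apart, so one is at least (1 -
  -- β)ρ from `y`. The new ball then stays (1 - 2β)ρ ≥ βρ away, as β < 1/3.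
  obtain ⟨u, hu, hy⟩ : ∃ u : ℂ, ‖u‖ = (1 - β) * B.radius ∧
      (1 - β) * B.radius ≤ ‖B.center i + u - y‖ := by
    set d := (1 - β) * B.radius with hd
    have hd0 : 0 ≤ d := mul_nonneg (by linarith) hρ.le
    have hn : ‖(d : ℂ)‖ = d := by rw [Complex.norm_real, Real.norm_of_nonneg hd0]
    by_contra! hcon
    have h1 := hcon d hn
    have h2 := hcon (-d) (by rw [norm_neg, hn])
    have h3 := norm_sub_le (B.center i + d - y) (B.center i + -d - y)
    have h4 : B.center i + d - y - (B.center i + -d - y) = ((2 * d : ℝ) : ℂ) := by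
      push_cast; ring
    rw [h4, Complex.norm_real, Real.norm_of_nonneg (by positivity)] at h3
    linarith
  refine ⟨⟨B.center + EuclideanSpace.single i u, β * B.radius, h⟩, rfl, fun z hz => ⟨?_, ?_⟩⟩
  · refine closedBall_subset_closedBall' ?_ hz
    rw [dist_eq_norm, add_sub_cancel_left, PiLp.norm_single, hu]
    linarith
  · rw [mem_coordNhd, not_lt]
    have h1 : ‖z i - (B.center i + u)‖ ≤ β * B.radius := by
      have h2 := PiLp.norm_apply_le (z - (B.center + EuclideanSpace.single i u)) i
      have h3 : ‖z - (B.center + EuclideanSpace.single i u)‖ ≤ β * B.radius := by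
        rw [← dist_eq_norm]; exact hz
      simp only [PiLp.sub_apply, PiLp.add_apply, PiLp.single_apply, if_true] at h2
      exact h2.trans h3
    have h5 := norm_sub_le_norm_sub_add_norm_sub (B.center i + u) (z i) y
    rw [norm_sub_rev (B.center i + u) (z i)] at h5
    nlinarith

/-- A rule answering every ball with a coordinate hyperplane, which may depend on the initial ball,
wins as soon as it wins all plays in which the radii tend to zero. -/
lemma isBetaHAW_of_coord [Nonempty ι] {β : ℝ} (hβ : 0 < β) (hβ' : β < 1 / 3)
    (A : Set (EuclideanSpace ℂ ι))
    (f : Ball (EuclideanSpace ℂ ι) → Ball (EuclideanSpace ℂ ι) → ι × ℂ)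
    (hf : ∀ B : ℕ → Ball (EuclideanSpace ℂ ι),
      (∀ j, (B (j + 1)).toSet ⊆ (B j).toSet) →
      (∀ j, ∀ z ∈ (B (j + 1)).toSet,
        β * (B j).radius ≤ ‖z (f (B 0) (B j)).1 - (f (B 0) (B j)).2‖) →
      (∀ j, β * (B j).radius ≤ (B (j + 1)).radius) →
      Tendsto (fun j => (B j).radius) atTop (𝓝 0) → (A ∩ ⋂ j, (B j).toSet).Nonempty) :
    IsBetaHAW β A := by
  let N : Ball (EuclideanSpace ℂ ι) → Ball (EuclideanSpace ℂ ι) →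
      HyperplaneNhd (EuclideanSpace ℂ ι) := fun B₀ B =>
    coordNhd (f B₀ B).1 (f B₀ B).2 (β * B.radius) (mul_pos hβ B.radius_pos)
  have key : ∀ B : ℕ → Ball (EuclideanSpace ℂ ι),
      (∀ j, (B (j + 1)).toSet ⊆ (B j).toSet \ (N (B 0) (B j)).toSet ∧
        β * (B j).radius ≤ (B (j + 1)).radius) →
      Tendsto (fun j => (B j).radius) atTop (𝓝 0) → (A ∩ ⋂ j, (B j).toSet).Nonempty := by
    intro B hB hlim
    refine hf B (fun j z hz => ((hB j).1 hz).1) (fun j z hz => ?_) (fun j => (hB j).2) hlim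
    have := ((hB j).1 hz).2
    rwa [mem_coordNhd, not_lt] at this
  refine ⟨fun j h => N (h 0) (h (Fin.last j)), fun j h => le_rfl, fun B hB => ?_⟩
  have hB' : ∀ j, (B (j + 1)).toSet ⊆ (B j).toSet \ (N (B 0) (B j)).toSet ∧
      β * (B j).radius ≤ (B (j + 1)).radius := fun j => by simpa using hB j
  by_cases hlim : Tendsto (fun j => (B j).radius) atTop (𝓝 0)
  · exact key B hB' hlim
  -- Otherwise some ball lies in every `B j`. A fictitious play started there, with radii shrinking
  -- by exactly β, produces a point of `A` in all the `B j`.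
  obtain ⟨B₀, hB₀⟩ :=
    Ball.exists_subset_of_not_tendsto (fun j z hz => ((hB' j).1 hz).1) hlim
  choose g hg hg' using fun b : Ball (EuclideanSpace ℂ ι) =>
    exists_ball_diff_coordNhd hβ hβ' b (f B₀ b).1 (f B₀ b).2 (mul_pos hβ b.radius_pos)
  let C : ℕ → Ball (EuclideanSpace ℂ ι) := fun j => g^[j] B₀
  have hC : ∀ j, C (j + 1) = g (C j) := fun j => Function.iterate_succ_apply' g j B₀
  have hrad : ∀ j, (C j).radius = β ^ j * B₀.radius := by
    intro j
    induction j with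
    | zero => simp [C]
    | succ j ih => rw [hC, hg, ih]; ring
  obtain ⟨z, hzA, hz⟩ := key C (fun j => by rw [hC]; exact ⟨hg' (C j), (hg (C j)).ge⟩) <| by
    simp only [hrad]
    simpa using (tendsto_pow_atTop_nhds_zero_of_lt_one hβ.le (by linarith)).mul_const B₀.radius
  refine ⟨z, hzA, Set.mem_iInter.mpr fun j => hB₀ j ?_⟩
  exact Set.mem_iInter.mp hz 0

end Coordinate

/-! ### The potential game with coordinate hyperplanes -/

section Potential

open scoped ENNReal Classical

variable {ι : Type*} [Fintype ι]

/-- An obstacle set `U i`, which inside a ball of radius at most `R i` is contained in a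
neighbourhood of width `w i` of a hyperplane `z (σ i) = x i B`, is active for the ball `B` if it
meets `B` and the radius of `B` is at most `R i`. -/
def IsActive {I : Type*} (U : I → Set (EuclideanSpace ℂ ι)) (R : I → ℝ)
    (B : Ball (EuclideanSpace ℂ ι)) (i : I) : Prop :=
  B.radius ≤ R i ∧ (U i ∩ B.toSet).Nonempty

/-- The potential of a ball: the sum of `w i ^ γ` over the active obstacles `i`. -/
def potential {I : Type*} (U : I → Set (EuclideanSpace ℂ ι)) (w R : I → ℝ) (γ : ℝ)
    (B : Ball (EuclideanSpace ℂ ι)) : ℝ≥0∞ :=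
  ∑' i, if IsActive U R B i then ENNReal.ofReal (w i ^ γ) else 0

lemma exists_finset_cover {δ : ℝ} (hδ : 0 < δ) :
    ∃ F : Finset ℂ, F.Nonempty ∧ ∀ x : ℂ, ‖x‖ ≤ 2 → ∃ y ∈ F, ‖x - y‖ < δ := by
  obtain ⟨t, -, htf, ht⟩ := (isCompact_closedBall (0 : ℂ) 2).finite_cover_balls hδ
  have hcov : ∀ x : ℂ, ‖x‖ ≤ 2 → ∃ y ∈ htf.toFinset, ‖x - y‖ < δ := by
    intro x hx
    have := ht (mem_closedBall_zero_iff.mpr hx)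
    simp only [Set.mem_iUnion, mem_ball, dist_eq_norm] at this
    obtain ⟨y, hy, hxy⟩ := this
    exact ⟨y, htf.mem_toFinset.mpr hy, hxy⟩
  obtain ⟨y, hy, -⟩ := hcov 0 (by simp)
  exact ⟨htf.toFinset, ⟨y, hy⟩, hcov⟩

/-- As γ tends to 0, β^γ tends to 1, so the loss from shrinking a ball by β becomes smaller than the
gain from deleting 1/N of the potential; the slack 1/(2N) is kept for new obstacles. -/
lemma exists_exponent {β N : ℝ} (hβ : 0 < β) (hN : 1 ≤ N) :
    ∃ γ : ℝ, 0 < γ ∧ 1 - 1 / N ≤ (1 - 1 / (2 * N)) * β ^ γ := by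
  have hlim : Tendsto (fun γ : ℝ => (1 - 1 / (2 * N)) * β ^ γ) (𝓝[>] 0)
      (𝓝 ((1 - 1 / (2 * N)) * β ^ (0 : ℝ))) :=
    ((Real.continuousAt_const_rpow hβ.ne').tendsto.const_mul _).mono_left nhdsWithin_le_nhds
  have hlt : 1 - 1 / N < (1 - 1 / (2 * N)) * β ^ (0 : ℝ) := by
    rw [Real.rpow_zero, mul_one]
    have : 1 / (2 * N) < 1 / N := one_div_lt_one_div_of_lt (by linarith) (by linarith)
    linarith
  obtain ⟨γ, h1, h2⟩ := ((hlim.eventually (lt_mem_nhds hlt)).and self_mem_nhdsWithin).exists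
  exact ⟨γ, h2, h1.le⟩

/-- One turn of the potential game: by removing the heaviest cell, Player A keeps the potential
below `κ ρ ^ γ`. -/
lemma exists_coord_move {I : Type*} [Nonempty ι] {β γ : ℝ} (hβ : 0 < β) (hβ' : β < 1 / 3)
    (hγ : 0 < γ) {F : Finset ℂ} (hF : ∀ x : ℂ, ‖x‖ ≤ 2 → ∃ y ∈ F, ‖x - y‖ < β / 2)
    (hFne : F.Nonempty) {N : ℝ} (hN : N = ((Finset.univ ×ˢ F : Finset (ι × ℂ)).card : ℝ))
    (hγN : 1 - 1 / N ≤ (1 - 1 / (2 * N)) * β ^ γ)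
    {U : I → Set (EuclideanSpace ℂ ι)} {σ : I → ι} {w R : I → ℝ} (hw : ∀ i, 0 < w i)
    (hU : ∀ i (B : Ball (EuclideanSpace ℂ ι)), B.radius ≤ R i →
      ∃ x : ℂ, ∀ z ∈ U i ∩ B.toSet, ‖z (σ i) - x‖ < w i)
    (hnew : ∀ ρ : ℝ, 0 < ρ →
      ∑' i, (if ρ ≤ R i ∧ R i < ρ / β then ENNReal.ofReal (w i ^ γ) else 0) ≤
        ENNReal.ofReal (1 / (2 * N) * ((β / 2) ^ γ * ρ ^ γ)))
    (B : Ball (EuclideanSpace ℂ ι))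
    (hB : potential U w R γ B ≤ ENNReal.ofReal ((β / 2) ^ γ * B.radius ^ γ)) :
    ∃ m : ι × ℂ, ∀ B' : Ball (EuclideanSpace ℂ ι), B'.toSet ⊆ B.toSet →
      (∀ z ∈ B'.toSet, β * B.radius ≤ ‖z m.1 - m.2‖) → β * B.radius ≤ B'.radius →
      potential U w R γ B' ≤ ENNReal.ofReal ((β / 2) ^ γ * B'.radius ^ γ) := by
  have hρ := B.radius_pos
  have hcard : 0 < (Finset.univ ×ˢ F : Finset (ι × ℂ)).card :=
    Finset.card_pos.mpr (Finset.univ_nonempty.product hFne)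
  have hN1 : 1 ≤ N := by rw [hN]; exact_mod_cast hcard
  have hx : ∀ i, ∃ x : ℂ, B.radius ≤ R i → ∀ z ∈ U i ∩ B.toSet, ‖z (σ i) - x‖ < w i := by
    intro i
    by_cases h : B.radius ≤ R i
    · exact (hU i B h).imp fun x hx _ => hx
    · exact ⟨0, fun h' => absurd h' h⟩
  choose x hx using hx
  -- A single active weight is bounded by the whole potential.
  have hwsmall : ∀ i, IsActive U R B i → w i ≤ β / 2 * B.radius := by
    intro i hi
    have h1 : ENNReal.ofReal (w i ^ γ) ≤ ENNReal.ofReal ((β / 2) ^ γ * B.radius ^ γ) := by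
      refine le_trans ?_ hB
      refine le_trans ?_ (ENNReal.le_tsum i)
      rw [if_pos hi]
    rw [ENNReal.ofReal_le_ofReal_iff (by positivity),
      ← Real.mul_rpow (by positivity) hρ.le] at h1
    exact (Real.rpow_le_rpow_iff (hw i).le (by positivity) hγ).mp h1
  -- A cell groups the active obstacles whose hyperplane is within βρ/2 of a given net hyperplane.
  -- Their widths are at most βρ/2, so the neighbourhood of width βρ contains all of them inside
  -- `B`.
  let cell : ι × ℂ → I → Prop := fun m i =>
    IsActive U R B i ∧ σ i = m.1 ∧ ‖x i - (B.center m.1 + B.radius * m.2)‖ < β / 2 * B.radius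
  have hcell : ∀ i, IsActive U R B i → ∃ m ∈ (Finset.univ ×ˢ F : Finset (ι × ℂ)), cell m i := by
    intro i hi
    obtain ⟨z, hz⟩ := hi.2
    have h1 := hx i hi.1 z hz
    have h2 : ‖z (σ i) - B.center (σ i)‖ ≤ B.radius := by
      have h3 := PiLp.norm_apply_le (z - B.center) (σ i)
      rw [← dist_eq_norm] at h3
      exact h3.trans hz.2
    have h4 : ‖x i - B.center (σ i)‖ ≤ 2 * B.radius := by
      have h5 := norm_sub_le_norm_sub_add_norm_sub (x i) (z (σ i)) (B.center (σ i))
      rw [norm_sub_rev (x i) (z (σ i))] at h5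
      nlinarith [hwsmall i hi]
    have hρC : (B.radius : ℂ) ≠ 0 := by exact_mod_cast hρ.ne'
    obtain ⟨y, hy, hxy⟩ := hF ((x i - B.center (σ i)) / B.radius) <| by
      rw [norm_div, Complex.norm_real, Real.norm_of_nonneg hρ.le, div_le_iff₀ hρ]
      exact h4
    refine ⟨(σ i, y), by simp [hy], hi, rfl, ?_⟩
    have h6 : x i - (B.center (σ i) + B.radius * y) =
        B.radius * ((x i - B.center (σ i)) / B.radius - y) := by
      field_simp
      ring
    rw [h6, norm_mul, Complex.norm_real, Real.norm_of_nonneg hρ.le, mul_comm]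
    exact mul_lt_mul_of_pos_right hxy hρ
  let φ : ι × ℂ → ℝ≥0∞ := fun m => ∑' i, if cell m i then ENNReal.ofReal (w i ^ γ) else 0
  have hsum : potential U w R γ B ≤ ∑ m ∈ (Finset.univ ×ˢ F : Finset (ι × ℂ)), φ m := by
    rw [← Summable.tsum_finsetSum fun _ _ => ENNReal.summable]
    refine ENNReal.tsum_le_tsum fun i => ?_
    split_ifs with hi
    · obtain ⟨m, hm, hmi⟩ := hcell i hi
      refine le_trans ?_ (Finset.single_le_sum (fun _ _ => zero_le) hm)
      rw [if_pos hmi]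
    · exact zero_le
  obtain ⟨m, hm, hmax⟩ := Finset.exists_max_image (Finset.univ ×ˢ F : Finset (ι × ℂ)) φ
    (Finset.card_pos.mp hcard)
  have hheavy : potential U w R γ B ≤ ENNReal.ofReal N * φ m := by
    refine hsum.trans ((Finset.sum_le_card_nsmul _ _ _ hmax).trans ?_)
    rw [nsmul_eq_mul, hN, ENNReal.ofReal_natCast]
  refine ⟨(m.1, B.center m.1 + B.radius * m.2), fun B' hBB' havoid hrad => ?_⟩
  have hρ' := B'.radius_pos
  -- An obstacle active for `B'` is either active for `B` and outside the deleted cell, or has R <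
  -- ρ(B) ≤ ρ(B')/β and is counted as new.
  have hle : potential U w R γ B' + φ m ≤ potential U w R γ B +
      ∑' i, (if B'.radius ≤ R i ∧ R i < B'.radius / β then ENNReal.ofReal (w i ^ γ) else 0) := by
    unfold potential
    rw [← ENNReal.tsum_add, ← ENNReal.tsum_add]
    refine ENNReal.tsum_le_tsum fun i => ?_
    by_cases hi' : IsActive U R B' i
    · by_cases hRi : B.radius ≤ R i
      · have hi : IsActive U R B i :=
          ⟨hRi, hi'.2.mono (Set.inter_subset_inter_right _ hBB')⟩
        have hnc : ¬ cell m i := by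
          rintro ⟨-, hσ, hc⟩
          obtain ⟨z, hzU, hzB'⟩ := hi'.2
          have h1 := hx i hRi z ⟨hzU, hBB' hzB'⟩
          have h2 := havoid z hzB'
          rw [hσ] at h1
          have h3 := norm_sub_le_norm_sub_add_norm_sub (z m.1) (x i)
            (B.center m.1 + B.radius * m.2)
          have h4 := hwsmall i hi
          simp only at h2
          linarith
        rw [if_pos hi', if_pos hi, if_neg hnc, add_zero]
        exact le_self_add
      · have hnew' : B'.radius ≤ R i ∧ R i < B'.radius / β := by
          refine ⟨hi'.1, ?_⟩
          rw [lt_div_iff₀ hβ]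
          nlinarith [not_le.mp hRi]
        have hnc : ¬ cell m i := fun h => hRi h.1.1
        rw [if_pos hi', if_pos hnew', if_neg hnc, add_zero]
        exact le_add_self
    · rw [if_neg hi', zero_add]
      refine le_trans ?_ le_self_add
      by_cases hc : cell m i
      · rw [if_pos hc, if_pos hc.1]
      · rw [if_neg hc]
        exact zero_le
  have hfin := hle.trans (add_le_add hB (hnew B'.radius hρ'))
  have hphi : φ m ≠ ∞ := by
    refine ne_top_of_le_ne_top ?_ (le_add_self.trans hfin)
    exact ENNReal.add_ne_top.mpr ⟨ENNReal.ofReal_ne_top, ENNReal.ofReal_ne_top⟩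
  have hpot : potential U w R γ B' ≠ ∞ := by
    refine ne_top_of_le_ne_top ?_ (le_self_add.trans hfin)
    exact ENNReal.add_ne_top.mpr ⟨ENNReal.ofReal_ne_top, ENNReal.ofReal_ne_top⟩
  have hpotB : potential U w R γ B ≠ ∞ := ne_top_of_le_ne_top ENNReal.ofReal_ne_top hB
  set a := (potential U w R γ B').toReal with ha
  set b := (potential U w R γ B).toReal with hb
  set p := (φ m).toReal with hp
  have hbA : b ≤ (β / 2) ^ γ * B.radius ^ γ := ENNReal.toReal_le_of_le_ofReal (by positivity) hB
  have hbp : b ≤ N * p := by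
    have := ENNReal.toReal_mono (ENNReal.mul_ne_top ENNReal.ofReal_ne_top hphi) hheavy
    rwa [ENNReal.toReal_mul, ENNReal.toReal_ofReal (by linarith)] at this
  have hapb : a + p ≤ b + 1 / (2 * N) * ((β / 2) ^ γ * B'.radius ^ γ) := by
    have h1 := hle.trans (add_le_add le_rfl (hnew B'.radius hρ'))
    have h2 := ENNReal.toReal_mono (ENNReal.add_ne_top.mpr ⟨hpotB, ENNReal.ofReal_ne_top⟩) h1
    rwa [ENNReal.toReal_add hpot hphi, ENNReal.toReal_add hpotB ENNReal.ofReal_ne_top,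
      ENNReal.toReal_ofReal (by positivity)] at h2
  refine (ENNReal.le_ofReal_iff_toReal_le hpot (by positivity)).mpr ?_
  rw [← ha]
  set k := (β / 2) ^ γ with hk
  have hk0 : 0 < k := by positivity
  have hshrink : β ^ γ * B.radius ^ γ ≤ B'.radius ^ γ := by
    rw [← Real.mul_rpow hβ.le hρ.le]
    exact Real.rpow_le_rpow (by positivity) hrad hγ.le
  have hη : 0 ≤ 1 - 1 / (2 * N) := by
    rw [sub_nonneg, div_le_one (by linarith)]; linarith
  have hη' : 0 ≤ 1 - 1 / N := by
    rw [sub_nonneg, div_le_one (by linarith)]; linarith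
  have hpb : b * (1 / N) ≤ p := by
    rw [mul_one_div, div_le_iff₀ (by linarith)]; linarith
  have h1 : b * (1 - 1 / N) ≤ k * B.radius ^ γ * (1 - 1 / N) :=
    mul_le_mul_of_nonneg_right hbA hη'
  have h2 : k * B.radius ^ γ * (1 - 1 / N) ≤
      k * B.radius ^ γ * ((1 - 1 / (2 * N)) * β ^ γ) :=
    mul_le_mul_of_nonneg_left hγN (by positivity)
  have h3 : k * (1 - 1 / (2 * N)) * (β ^ γ * B.radius ^ γ) ≤
      k * (1 - 1 / (2 * N)) * B'.radius ^ γ :=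
    mul_le_mul_of_nonneg_left hshrink (by positivity)
  linarith [h1, h2, h3]

/-- The winning criterion: there are an exponent `γ` and a constant `κ`, depending only on `β` and
the dimension, such that `A` is winning if its complement is covered by obstacles whose total
weights are small at the initial ball and at every scale. -/
theorem exists_potential_criterion.{u} (ι : Type u) [Fintype ι] [Nonempty ι] {β : ℝ} (hβ : 0 < β)
    (hβ' : β < 1 / 3) :
    ∃ γ κ : ℝ, 0 < γ ∧ 0 < κ ∧ ∀ A : Set (EuclideanSpace ℂ ι),
      (∀ ρ₀ : ℝ, 0 < ρ₀ → ∃ (I : Type u) (U : I → Set (EuclideanSpace ℂ ι)) (σ : I → ι)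
        (w R : I → ℝ), (∀ i, 0 < w i) ∧ (∀ i, 0 < R i) ∧ (∀ z, (∀ i, z ∉ U i) → z ∈ A) ∧
        (∀ i (B : Ball (EuclideanSpace ℂ ι)), B.radius ≤ R i →
          ∃ x : ℂ, ∀ z ∈ U i ∩ B.toSet, ‖z (σ i) - x‖ < w i) ∧
        (∑' i, (if ρ₀ ≤ R i then ENNReal.ofReal (w i ^ γ) else 0) ≤
          ENNReal.ofReal (κ * ρ₀ ^ γ)) ∧
        ∀ ρ : ℝ, 0 < ρ →
          ∑' i, (if ρ ≤ R i ∧ R i < ρ / β then ENNReal.ofReal (w i ^ γ) else 0) ≤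
            ENNReal.ofReal (κ * ρ ^ γ)) →
      IsBetaHAW β A := by
  obtain ⟨F, hFne, hF⟩ := exists_finset_cover (half_pos hβ)
  obtain ⟨N, hN⟩ : ∃ N : ℝ, N = ((Finset.univ ×ˢ F : Finset (ι × ℂ)).card : ℝ) := ⟨_, rfl⟩
  have hN1 : 1 ≤ N := by
    have hcard : 0 < (Finset.univ ×ˢ F : Finset (ι × ℂ)).card :=
      Finset.card_pos.mpr (Finset.univ_nonempty.product hFne)
    rw [hN]
    exact_mod_cast hcard
  obtain ⟨γ, hγ, hγN⟩ := exists_exponent hβ hN1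
  refine ⟨γ, 1 / (2 * N) * (β / 2) ^ γ, hγ, by positivity, fun A hA => ?_⟩
  choose I U σ w R hw hR hUA hU hinit hnew using fun B₀ : Ball (EuclideanSpace ℂ ι) =>
    hA B₀.radius B₀.radius_pos
  have hmove : ∀ B₀ B : Ball (EuclideanSpace ℂ ι), ∃ m : ι × ℂ,
      potential (U B₀) (w B₀) (R B₀) γ B ≤ ENNReal.ofReal ((β / 2) ^ γ * B.radius ^ γ) →
      ∀ B' : Ball (EuclideanSpace ℂ ι), B'.toSet ⊆ B.toSet →
      (∀ z ∈ B'.toSet, β * B.radius ≤ ‖z m.1 - m.2‖) → β * B.radius ≤ B'.radius →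
      potential (U B₀) (w B₀) (R B₀) γ B' ≤
        ENNReal.ofReal ((β / 2) ^ γ * B'.radius ^ γ) := by
    intro B₀ B
    by_cases hB : potential (U B₀) (w B₀) (R B₀) γ B ≤
        ENNReal.ofReal ((β / 2) ^ γ * B.radius ^ γ)
    · obtain ⟨m, hm⟩ := exists_coord_move hβ hβ' hγ hF hFne hN hγN (hw B₀) (hU B₀)
        (fun ρ hρ => by rw [← mul_assoc]; exact hnew B₀ ρ hρ) B hB
      exact ⟨m, fun _ => hm⟩
    · exact ⟨(Classical.arbitrary ι, 0), fun h => absurd h hB⟩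
  choose f hf using hmove
  refine isBetaHAW_of_coord hβ hβ' A f fun B hsub havoid hrad hlim => ?_
  have hpot : ∀ j, potential (U (B 0)) (w (B 0)) (R (B 0)) γ (B j) ≤
      ENNReal.ofReal ((β / 2) ^ γ * (B j).radius ^ γ) := by
    intro j
    induction j with
    | zero =>
      refine le_trans (ENNReal.tsum_le_tsum fun i => ?_) ((hinit (B 0)).trans ?_)
      · split_ifs with h1 h2 h2
        · exact le_rfl
        · exact absurd h1.1 h2
        · exact zero_le
        · exact le_rfl
      · refine ENNReal.ofReal_le_ofReal ?_
        have := (B 0).radius_pos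
        rw [mul_assoc]
        refine mul_le_of_le_one_left (by positivity) ?_
        rw [div_le_one (by linarith)]; linarith
    | succ j ih => exact hf (B 0) (B j) ih (B (j + 1)) (hsub j) (havoid j) (hrad j)
  have hanti := Ball.toSet_antitone hsub
  obtain ⟨z, hz⟩ : (⋂ j, (B j).toSet).Nonempty := by
    refine IsCompact.nonempty_iInter_of_sequence_nonempty_isCompact_isClosed _ hsub
      (fun j => ⟨(B j).center, mem_closedBall_self (B j).radius_pos.le⟩)
      (isCompact_closedBall _ _) fun j => isClosed_closedBall
  refine ⟨z, hUA (B 0) z fun i hi => ?_, hz⟩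
  have hlim' : Tendsto (fun j => (β / 2) ^ γ * (B j).radius ^ γ) atTop (𝓝 0) := by
    have := ((Real.continuousAt_rpow_const 0 γ (Or.inr hγ.le)).tendsto.comp hlim).const_mul
      ((β / 2) ^ γ)
    simpa [Real.zero_rpow hγ.ne'] using this
  -- An obstacle containing the limit point would be active for all small balls, while the potential
  -- falls below its fixed weight.
  obtain ⟨j, h1, h2⟩ := ((hlim.eventually (gt_mem_nhds (hR (B 0) i))).and
    (hlim'.eventually (gt_mem_nhds (Real.rpow_pos_of_pos (hw (B 0) i) γ)))).exists
  have hact : IsActive (U (B 0)) (R (B 0)) (B j) i :=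
    ⟨h1.le, z, hi, Set.mem_iInter.mp hz j⟩
  have h3 : ENNReal.ofReal (w (B 0) i ^ γ) ≤
      ENNReal.ofReal ((β / 2) ^ γ * (B j).radius ^ γ) := by
    refine le_trans ?_ (hpot j)
    refine le_trans ?_ (ENNReal.le_tsum i)
    rw [if_pos hact]
  rw [ENNReal.ofReal_le_ofReal_iff (by have := (B j).radius_pos; positivity)] at h3
  linarith

end Potential

/-! ### Uniform bounds for two-sided geometric sums -/

section Sums

open scoped ENNReal

lemma tsum_int_two_rpow_ne_top {δ : ℝ} (hδ : 0 < δ) :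
    ∑' m : ℤ, ENNReal.ofReal ((2 : ℝ) ^ (-δ * |(m : ℝ)|)) ≠ ∞ := by
  have hlt : (2 : ℝ) ^ (-δ) < 1 := Real.rpow_lt_one_of_one_lt_of_neg (by norm_num) (by linarith)
  have hnat : Summable fun n : ℕ => (2 : ℝ) ^ (-δ * (n : ℝ)) := by
    simp_rw [Real.rpow_mul_natCast (zero_le_two : (0 : ℝ) ≤ 2)]
    exact summable_geometric_of_lt_one (by positivity) hlt
  have hs : Summable fun m : ℤ => (2 : ℝ) ^ (-δ * |(m : ℝ)|) :=
    Summable.of_nat_of_neg (by simpa using hnat) (by simpa using hnat)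
  rw [← ENNReal.ofReal_tsum_of_nonneg (fun _ => by positivity) hs]
  exact ENNReal.ofReal_ne_top

/-- Replacing x/s by its floor costs a bounded factor, and translation embeds the sum into one over
ℤ that no longer depends on `x`. -/
lemma exists_tsum_two_rpow_le {δ s : ℝ} (hδ : 0 < δ) (hs : 0 < s) :
    ∃ C : ℝ≥0∞, C ≠ ∞ ∧
      ∀ x : ℝ, ∑' a : ℕ, ENNReal.ofReal ((2 : ℝ) ^ (-δ * |s * a - x|)) ≤ C := by
  refine ⟨ENNReal.ofReal (2 ^ (δ * s)) *
    ∑' m : ℤ, ENNReal.ofReal ((2 : ℝ) ^ (-(δ * s) * |(m : ℝ)|)),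
    ENNReal.mul_ne_top ENNReal.ofReal_ne_top (tsum_int_two_rpow_ne_top (mul_pos hδ hs)),
    fun x => ?_⟩
  rw [← ENNReal.tsum_mul_left]
  refine le_trans (ENNReal.tsum_le_tsum fun a => ?_)
    (ENNReal.tsum_comp_le_tsum_of_injective (f := fun a : ℕ => (a : ℤ) - ⌊x / s⌋)
      (fun a b h => by simpa using h) fun m : ℤ => ENNReal.ofReal (2 ^ (δ * s)) *
        ENNReal.ofReal ((2 : ℝ) ^ (-(δ * s) * |(m : ℝ)|)))
  rw [← ENNReal.ofReal_mul (by positivity), ← Real.rpow_add two_pos]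
  refine ENNReal.ofReal_le_ofReal (Real.rpow_le_rpow_of_exponent_le one_le_two ?_)
  have h1 : |(a : ℝ) - ⌊x / s⌋| ≤ |(a : ℝ) - x / s| + 1 := by
    have h2 := Int.floor_le (x / s)
    have h3 := Int.lt_floor_add_one (x / s)
    have h4 : |x / s - ⌊x / s⌋| ≤ 1 := abs_le.mpr ⟨by linarith, by linarith⟩
    exact (abs_sub_le (a : ℝ) (x / s) ⌊x / s⌋).trans (by linarith)
  have h5 : |s * a - x| = s * |(a : ℝ) - x / s| := by
    rw [← abs_of_pos hs, ← abs_mul, abs_of_pos hs, mul_sub, mul_div_cancel₀ _ hs.ne']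
  have h6 := mul_le_mul_of_nonneg_left h1 (mul_pos hδ hs).le
  push_cast
  rw [h5]
  linarith

lemma exists_tsum_prod_two_rpow_le {T : Type*} [Finite T] {δ : ℝ} (hδ : 0 < δ) {s : T → ℝ}
    (hs : ∀ t, 0 < s t) :
    ∃ C : ℝ, 0 < C ∧ ∀ x : ℝ, ∑' i : T × ℕ × ℕ, ENNReal.ofReal
      ((2 : ℝ) ^ (-δ * |(i.2.1 : ℝ) - x|) * 2 ^ (-δ * |s i.1 * i.2.2 - i.2.1|)) ≤
        ENNReal.ofReal C := by
  have := Fintype.ofFinite T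
  obtain ⟨C₀, hC₀, h₀⟩ := exists_tsum_two_rpow_le hδ one_pos
  choose C hC hCs using fun t => exists_tsum_two_rpow_le hδ (hs t)
  have hfin : ∑ t, C₀ * C t ≠ ∞ := ENNReal.sum_ne_top.mpr fun t _ => ENNReal.mul_ne_top hC₀ (hC t)
  refine ⟨(∑ t, C₀ * C t).toReal + 1, by positivity, fun x => ?_⟩
  refine le_trans ?_ (ENNReal.ofReal_le_ofReal (le_add_of_nonneg_right zero_le_one))
  rw [ENNReal.ofReal_toReal hfin, ENNReal.tsum_prod', tsum_fintype]
  refine Finset.sum_le_sum fun t _ => ?_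
  rw [ENNReal.tsum_prod']
  simp_rw [ENNReal.ofReal_mul (Real.rpow_nonneg (zero_le_two : (0 : ℝ) ≤ 2) _),
    ENNReal.tsum_mul_left]
  refine le_trans (ENNReal.tsum_le_tsum fun b => mul_le_mul_right (hCs t b) _) ?_
  rw [ENNReal.tsum_mul_right]
  refine mul_le_mul_left ?_ _
  simpa using h₀ x

end Sums

/-! ### Obstacles from rational points -/

section Obstacles

variable {K : Type*} [Field K] [NumberField K]

/-- The points at which some pair `(p, q)` violates the condition with constant `c`, where `q` has
`r`-norm about `2 ^ a`, where the maximum of `‖σ' q‖ Q ^ r σ'` is attained at `σ` and is about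
`2 ^ b`, and where `τ` minimizes `|2 r τ' a - b|` over the embeddings of positive weight. -/
def obstacle (r : (K →+* ℂ) → ℝ) (c : ℝ) (σ τ : K →+* ℂ) (b a : ℕ) :
    Set (EuclideanSpace ℂ (K →+* ℂ)) :=
  {z | ∃ (p q : 𝓞 K) (Q : ℝ), q ≠ 0 ∧ (2 : ℝ) ^ (a : ℝ) ≤ Q ∧ Q < 2 ^ ((a : ℝ) + 1) ∧
    (∀ σ' : K →+* ℂ, ‖σ' (q : K)‖ ≤ Q ^ r σ') ∧
    (∀ σ' : K →+* ℂ, Q ^ r σ' * ‖σ' (q : K) * z σ' + σ' (p : K)‖ < c) ∧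
    (∀ σ' : K →+* ℂ, ‖σ' (q : K)‖ * Q ^ r σ' ≤ ‖σ (q : K)‖ * Q ^ r σ) ∧
    (2 : ℝ) ^ (b : ℝ) ≤ ‖σ (q : K)‖ * Q ^ r σ ∧ ‖σ (q : K)‖ * Q ^ r σ < 2 ^ ((b : ℝ) + 1) ∧
    ∀ σ' : K →+* ℂ, 0 < r σ' → |2 * r τ * a - b| ≤ |2 * r σ' * a - b|}

/-- A nonzero algebraic integer has a conjugate of modulus at least 1. -/
lemma eq_of_forall_norm_sub_lt_one {x y : 𝓞 K}
    (h : ∀ σ : K →+* ℂ, ‖σ (x : K) - σ (y : K)‖ < 1) : x = y := by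
  by_contra hxy
  obtain ⟨σ, hσ⟩ := exists_conjugate_one_le_norm (sub_ne_zero.mpr hxy)
  have := h σ
  rw [← map_sub, ← map_sub] at this
  exact absurd hσ (not_le.mpr this)

/-- The determinant splits into two approximation errors, each at most 2c ≤ 1/8, and uu'(z - z'), at
most 1/4. For the last, `u` and `u'` are bounded by Q^r if 2ra ≤ b, by 2^(b+1)/Q^r if 2ra ≥ b, and
by 1 if r = 0. -/
lemma norm_det_lt_one {u v u' v' z z' : ℂ} {Q Q' r a b c ρ s : ℝ} (hr : 0 ≤ r) (hr1 : r ≤ 1)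
    (hc : c ≤ 1 / 16) (hs : s ≤ b + 1) (hsr : 0 < r → s ≤ |2 * r * a - b|)
    (hρ : ρ ≤ 2 ^ (s - b - 5)) (hz : ‖z - z'‖ ≤ 2 * ρ)
    (hQ : 2 ^ a ≤ Q) (hQ2 : Q < 2 ^ (a + 1)) (hQ' : 2 ^ a ≤ Q') (hQ2' : Q' < 2 ^ (a + 1))
    (hu : ‖u‖ ≤ Q ^ r) (hu' : ‖u'‖ ≤ Q' ^ r)
    (hz1 : Q ^ r * ‖u * z + v‖ < c) (hz1' : Q' ^ r * ‖u' * z' + v'‖ < c)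
    (hH : ‖u‖ * Q ^ r < 2 ^ (b + 1)) (hH' : ‖u'‖ * Q' ^ r < 2 ^ (b + 1)) :
    ‖u * v' - u' * v‖ < 1 := by
  have ha : (0 : ℝ) < 2 ^ a := by positivity
  have hQ0 : 0 < Q := ha.trans_le hQ
  have hQ0' : 0 < Q' := ha.trans_le hQ'
  have htwo : (2 : ℝ) ^ r ≤ 2 := by
    simpa using Real.rpow_le_rpow_of_exponent_le (one_le_two (α := ℝ)) hr1
  have hcomp : ∀ {x y : ℝ}, 0 < x → 0 < y → x < 2 ^ (a + 1) → 2 ^ a ≤ y → x ^ r ≤ 2 * y ^ r := by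
    intro x y hx hy hxa hya
    rw [Real.rpow_add two_pos, Real.rpow_one] at hxa
    have h1 : x ≤ 2 * y := by linarith
    calc x ^ r ≤ (2 * y) ^ r := Real.rpow_le_rpow hx.le h1 hr
      _ = 2 ^ r * y ^ r := Real.mul_rpow zero_le_two hy.le
      _ ≤ 2 * y ^ r := mul_le_mul_of_nonneg_right htwo (by positivity)
  have h1 : ‖u‖ * ‖u' * z' + v'‖ ≤ 2 * c := by
    have := mul_le_mul_of_nonneg_right (hu.trans (hcomp hQ0 hQ0' hQ2 hQ'))
      (norm_nonneg (u' * z' + v'))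
    linarith
  have h2 : ‖u'‖ * ‖u * z + v‖ ≤ 2 * c := by
    have := mul_le_mul_of_nonneg_right (hu'.trans (hcomp hQ0' hQ0 hQ2' hQ))
      (norm_nonneg (u * z + v))
    linarith
  have hkey : ∀ {m : ℝ}, 0 ≤ m → ‖u‖ ≤ 2 * m → ‖u'‖ ≤ 2 * m → m * m * ρ ≤ 1 / 32 →
      ‖u‖ * ‖u'‖ * ‖z - z'‖ ≤ 1 / 4 := by
    intro m hm hum hum' hmρ
    calc ‖u‖ * ‖u'‖ * ‖z - z'‖ ≤ (2 * m) * (2 * m) * (2 * ρ) := by gcongr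
      _ ≤ 1 / 4 := by linarith
  have h3 : ‖u‖ * ‖u'‖ * ‖z - z'‖ ≤ 1 / 4 := by
    have h32 : (2 : ℝ) ^ (-5 : ℝ) = 1 / 32 := by
      rw [Real.rpow_neg zero_le_two]; norm_num
    rcases hr.lt_or_eq with hr0 | hr0
    · have hs' := hsr hr0
      rcases le_total (2 * r * a) b with hab | hab
      · rw [abs_of_nonpos (by linarith)] at hs'
        have hb : ∀ {x : ℝ}, 0 < x → x < 2 ^ (a + 1) → x ^ r ≤ 2 * 2 ^ (a * r) := by
          intro x hx hxa
          rw [Real.rpow_mul zero_le_two]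
          exact hcomp hx ha hxa le_rfl
        refine hkey (by positivity) (hu.trans (hb hQ0 hQ2)) (hu'.trans (hb hQ0' hQ2')) ?_
        calc (2 : ℝ) ^ (a * r) * 2 ^ (a * r) * ρ
            ≤ 2 ^ (a * r) * 2 ^ (a * r) * 2 ^ (s - b - 5) := by gcongr
          _ = 2 ^ (a * r + a * r + (s - b - 5)) := by
            rw [Real.rpow_add two_pos, Real.rpow_add two_pos]
          _ ≤ 2 ^ (-5 : ℝ) := Real.rpow_le_rpow_of_exponent_le one_le_two (by linarith)
          _ = 1 / 32 := h32
      · rw [abs_of_nonneg (by linarith)] at hs'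
        have hb : ∀ {x y : ℝ}, 0 ≤ y → 2 ^ a ≤ x → y * x ^ r < 2 ^ (b + 1) →
            y ≤ 2 * 2 ^ (b - a * r) := by
          intro x y hy hax hyx
          have h5 : (2 : ℝ) ^ (a * r) ≤ x ^ r := by
            rw [Real.rpow_mul zero_le_two]
            exact Real.rpow_le_rpow ha.le hax hr
          have h6 := (mul_le_mul_of_nonneg_left h5 hy).trans hyx.le
          rw [Real.rpow_sub two_pos, ← mul_div_assoc, le_div_iff₀ (by positivity)]
          rwa [Real.rpow_add two_pos, Real.rpow_one, mul_comm _ (2 : ℝ)] at h6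
        refine hkey (by positivity) (hb (norm_nonneg _) hQ hH) (hb (norm_nonneg _) hQ' hH') ?_
        calc (2 : ℝ) ^ (b - a * r) * 2 ^ (b - a * r) * ρ
            ≤ 2 ^ (b - a * r) * 2 ^ (b - a * r) * 2 ^ (s - b - 5) := by gcongr
          _ = 2 ^ (b - a * r + (b - a * r) + (s - b - 5)) := by
            rw [Real.rpow_add two_pos, Real.rpow_add two_pos]
          _ ≤ 2 ^ (-5 : ℝ) := Real.rpow_le_rpow_of_exponent_le one_le_two (by linarith)
          _ = 1 / 32 := h32
    · rw [← hr0, Real.rpow_zero] at hu hu'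
      refine hkey (m := 1 / 2) (by norm_num) (by linarith) (by linarith) ?_
      -- At weight zero nothing relates `s` to 2ra - b; here s ≤ b + 1 alone keeps ρ below 1/16.
      have h7 : (2 : ℝ) ^ (s - b - 5) ≤ 2 ^ (-4 : ℝ) :=
        Real.rpow_le_rpow_of_exponent_le one_le_two (by linarith)
      have h8 : (2 : ℝ) ^ (-4 : ℝ) = 1 / 16 := by
        rw [Real.rpow_neg zero_le_two]; norm_num
      have h9 := hρ.trans (h7.trans_eq h8)
      linarith
  have hid : u * v' - u' * v = u * (u' * z' + v') - u' * (u * z + v) + u * u' * (z - z') := by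
    ring
  calc ‖u * v' - u' * v‖
      ≤ ‖u * (u' * z' + v')‖ + ‖u' * (u * z + v)‖ + ‖u * u' * (z - z')‖ := by
        rw [hid]
        exact (norm_add_le _ _).trans (add_le_add_left (norm_sub_le _ _) _)
    _ = ‖u‖ * ‖u' * z' + v'‖ + ‖u'‖ * ‖u * z + v‖ + ‖u‖ * ‖u'‖ * ‖z - z'‖ := by
        simp only [norm_mul]
    _ < 1 := by linarith

lemma exists_center_of_obstacle {r : (K →+* ℂ) → ℝ} (hr : ∀ σ, 0 ≤ r σ) (hr1 : ∀ σ, r σ ≤ 1)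
    {c : ℝ} (hc : c ≤ 1 / 16) {σ τ : K →+* ℂ} {b a : ℕ}
    (hs : |2 * r τ * a - b| ≤ (b : ℝ) + 1) (B : Ball (EuclideanSpace ℂ (K →+* ℂ)))
    (hB : B.radius ≤ 2 ^ (|2 * r τ * a - b| - b - 5)) :
    ∃ x : ℂ, ∀ z ∈ obstacle r c σ τ b a ∩ B.toSet, ‖z σ - x‖ < c * 2 ^ (-(b : ℝ)) := by
  rcases (obstacle r c σ τ b a ∩ B.toSet).eq_empty_or_nonempty with he | ⟨z', hz', hzB'⟩
  · exact ⟨0, fun z hz => by simp [he] at hz⟩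
  obtain ⟨p', q', Q', hq', hQ', hQ2', hqQ', hz1', hmax', hH', hH2', -⟩ := hz'
  refine ⟨-(σ (p' : K) / σ (q' : K)), ?_⟩
  rintro z ⟨⟨p, q, Q, hq, hQ, hQ2, hqQ, hz1, hmax, hH, hH2, hmin⟩, hzB⟩
  have hdist : ‖z - z'‖ ≤ 2 * B.radius := by
    rw [← dist_eq_norm, two_mul]
    exact (dist_triangle_right z z' B.center).trans (add_le_add hzB hzB')
  have hdet : q * p' = q' * p := by
    refine eq_of_forall_norm_sub_lt_one fun σ' => ?_
    simp only [map_mul]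
    refine norm_det_lt_one (hr σ') (hr1 σ') hc hs (hmin σ') hB
      (z := z σ') (z' := z' σ') ?_ hQ hQ2 hQ' hQ2' (hqQ σ') (hqQ' σ') (hz1 σ') (hz1' σ')
      ((hmax σ').trans_lt hH2) ((hmax' σ').trans_lt hH2')
    exact (PiLp.norm_apply_le (z - z') σ').trans hdist
  have hne : ∀ {x : 𝓞 K}, x ≠ 0 → σ (x : K) ≠ 0 := fun hx => by simpa using hx
  have hdet' : σ (q : K) * σ (p' : K) = σ (q' : K) * σ (p : K) := by
    rw [← map_mul, ← map_mul, ← map_mul, ← map_mul, hdet]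
  have heq : σ (q : K) * (z σ - -(σ (p' : K) / σ (q' : K))) = σ (q : K) * z σ + σ (p : K) := by
    have := hne hq'
    field_simp
    linear_combination hdet'
  have hQ0 : 0 < Q := lt_of_lt_of_le (by positivity) hQ
  have h1 := hz1 σ
  rw [← heq, norm_mul] at h1
  have h2 := mul_le_mul_of_nonneg_right hH (norm_nonneg (z σ - -(σ (p' : K) / σ (q' : K))))
  rw [Real.rpow_neg zero_le_two, ← div_eq_mul_inv, lt_div_iff₀ (by positivity)]
  linarith

lemma exists_two_rpow_near {x : ℝ} (hx : 1 ≤ x) :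
    ∃ n : ℕ, (2 : ℝ) ^ (n : ℝ) ≤ x ∧ x < 2 ^ ((n : ℝ) + 1) := by
  obtain ⟨n, h1, h2⟩ := exists_nat_pow_near hx one_lt_two
  exact ⟨n, by rwa [Real.rpow_natCast], by exact_mod_cast h2⟩

lemma exists_mem_obstacle {r : (K →+* ℂ) → ℝ} (hr : ∀ σ, 0 ≤ r σ) (hr1 : ∑ σ, r σ = 1)
    {c : ℝ} (hc : c ≤ 1) {z : EuclideanSpace ℂ (K →+* ℂ)} {p q : 𝓞 K} (hq : q ≠ 0)
    (h : approxQuality r z p q < c) :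
    ∃ (σ τ : K →+* ℂ) (b a : ℕ), 0 < r τ ∧ |2 * r τ * a - b| ≤ (b : ℝ) + 1 ∧
      z ∈ obstacle r c σ τ b a := by
  obtain ⟨h1, h2⟩ := max_lt_iff.mp h
  have hpos : ∀ σ : K →+* ℂ, 0 < ‖σ (q : K)‖ := fun σ => norm_pos_iff.mpr (by simpa using hq)
  have hne : Nonempty {σ : K →+* ℂ // 0 < r σ} := by
    by_contra hcon
    have h0 : ∀ σ, r σ = 0 := fun σ =>
      le_antisymm (not_lt.mp fun hσ => hcon ⟨⟨σ, hσ⟩⟩) (hr σ)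
    simp [h0] at hr1
  obtain ⟨Q, hQ⟩ : ∃ Q, Q = rNorm r (q : K) := ⟨_, rfl⟩
  obtain ⟨ν, hν⟩ := exists_eq_ciSup_of_finite
    (f := fun σ : {σ : K →+* ℂ // 0 < r σ} => ‖σ.1 (q : K)‖ ^ (1 / r σ.1))
  have hQν : Q = ‖ν.1 (q : K)‖ ^ (1 / r ν.1) := hQ.trans hν.symm
  have hQ0 : 0 < Q := by rw [hQν]; exact Real.rpow_pos_of_pos (hpos _) _
  have hroot : ∀ {x s : ℝ}, 0 ≤ x → 0 < s → (x ^ (1 / s)) ^ s = x := fun hx hs => by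
    rw [← Real.rpow_mul hx, one_div_mul_cancel hs.ne', Real.rpow_one]
  have hνeq : Q ^ r ν.1 = ‖ν.1 (q : K)‖ := by rw [hQν, hroot (norm_nonneg _) ν.2]
  have hzero : ∀ σ : K →+* ℂ, r σ = 0 →
      ‖σ (q : K) * z σ + σ (p : K)‖ < c ∧ ‖σ (q : K)‖ < c := fun σ hσ =>
    max_lt_iff.mp ((le_ciSup (f := fun σ : {σ : K →+* ℂ // r σ = 0} =>
      max ‖σ.1 (q : K) * z σ.1 + σ.1 (p : K)‖ ‖σ.1 (q : K)‖)
      (Set.finite_range _).bddAbove ⟨σ, hσ⟩).trans_lt h2)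
  have hqQ : ∀ σ : K →+* ℂ, ‖σ (q : K)‖ ≤ Q ^ r σ := by
    intro σ
    rcases (hr σ).lt_or_eq with hσ | hσ
    · have h3 : ‖σ (q : K)‖ ^ (1 / r σ) ≤ Q := by
        rw [hQ]
        exact le_ciSup (f := fun σ : {σ : K →+* ℂ // 0 < r σ} => ‖σ.1 (q : K)‖ ^ (1 / r σ.1))
          (Set.finite_range _).bddAbove ⟨σ, hσ⟩
      have h4 := Real.rpow_le_rpow (by positivity) h3 hσ.le
      rwa [hroot (norm_nonneg _) hσ] at h4
    · rw [← hσ, Real.rpow_zero]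
      exact (hzero σ hσ.symm).2.le.trans hc
  have hz : ∀ σ : K →+* ℂ, Q ^ r σ * ‖σ (q : K) * z σ + σ (p : K)‖ < c := by
    intro σ
    rcases (hr σ).lt_or_eq with hσ | hσ
    · rw [hQ]
      exact (le_ciSup (f := fun σ : {σ : K →+* ℂ // 0 < r σ} =>
        rNorm r (q : K) ^ r σ.1 * ‖σ.1 (q : K) * z σ.1 + σ.1 (p : K)‖)
        (Set.finite_range _).bddAbove ⟨σ, hσ⟩).trans_lt h1
    · rw [← hσ, Real.rpow_zero, one_mul]
      exact (hzero σ hσ.symm).1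
  -- Some conjugate of `q` has modulus at least 1; it has positive weight, since at weight zero the
  -- conjugates are below c ≤ 1.
  have hQ1 : 1 ≤ Q := by
    obtain ⟨σ, hσ⟩ := exists_conjugate_one_le_norm hq
    rcases (hr σ).lt_or_eq with hσ' | hσ'
    · by_contra hcon
      exact absurd (hσ.trans (hqQ σ))
        (not_le.mpr (Real.rpow_lt_one hQ0.le (not_le.mp hcon) hσ'))
    · exact absurd ((hzero σ hσ'.symm).2.trans_le hc) (not_lt.mpr hσ)
  obtain ⟨σ, hσ⟩ := Finite.exists_max fun σ : K →+* ℂ => ‖σ (q : K)‖ * Q ^ r σ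
  have hH1 : 1 ≤ ‖σ (q : K)‖ * Q ^ r σ := by
    refine le_trans ?_ (hσ ν.1)
    rw [← hνeq]
    have := Real.one_le_rpow hQ1 ν.2.le
    nlinarith
  obtain ⟨a, ha, ha'⟩ := exists_two_rpow_near hQ1
  obtain ⟨b, hb, hb'⟩ := exists_two_rpow_near hH1
  obtain ⟨τ, hτ⟩ := Finite.exists_min fun τ : {σ : K →+* ℂ // 0 < r σ} => |2 * r τ.1 * a - b|
  refine ⟨σ, τ.1, b, a, τ.2, (hτ ν).trans ?_, p, q, Q, hq, ha, ha', hqQ, hz, hσ, hb, hb',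
    fun σ' hσ' => hτ ⟨σ', hσ'⟩⟩
  -- The embedding ν attaining the r-norm has |ν(q)| Q^{r_ν} = Q^{2r_ν}, so 2 r_ν a < b + 1; this is
  -- what bounds the minimum over τ by b + 1.
  have h5 : (2 : ℝ) ^ (2 * r ν.1 * a) < 2 ^ ((b : ℝ) + 1) := by
    refine lt_of_le_of_lt ?_ ((hσ ν.1).trans_lt hb')
    have h6 : (2 : ℝ) ^ ((a : ℝ) * r ν.1) ≤ Q ^ r ν.1 := by
      rw [Real.rpow_mul zero_le_two]
      exact Real.rpow_le_rpow (by positivity) ha ν.2.le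
    rw [← hνeq, show 2 * r ν.1 * (a : ℝ) = a * r ν.1 + a * r ν.1 by ring,
      Real.rpow_add two_pos]
    exact mul_le_mul h6 h6 (by positivity) (by positivity)
  rw [Real.rpow_lt_rpow_left_iff one_lt_two] at h5
  have h7 : 0 ≤ 2 * r ν.1 * a := mul_nonneg (mul_nonneg zero_le_two ν.2.le) (Nat.cast_nonneg a)
  have h8 : (0 : ℝ) ≤ b := Nat.cast_nonneg b
  rw [abs_le]
  constructor <;> linarith

end Obstacles

/-! ### Trading the weight 2^(-bγ) for decay in both dyadic scales -/

section Weights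

lemma exists_small_constant {γ A B κ : ℝ} (hγ : 0 < γ) (hκ : 0 < κ) :
    ∃ c : ℝ, 0 < c ∧ c ≤ 1 / 16 ∧ c ^ γ * A ≤ κ ∧ c ^ γ * B ≤ κ := by
  have hlim : Tendsto (fun c : ℝ => c ^ γ) (𝓝[>] 0) (𝓝 0) := by
    have := (Real.continuousAt_rpow_const 0 γ (Or.inr hγ.le)).tendsto
    rw [Real.zero_rpow hγ.ne'] at this
    exact this.mono_left nhdsWithin_le_nhds
  have hsmall : ∀ D : ℝ, ∀ᶠ c : ℝ in 𝓝[>] 0, c ^ γ * D ≤ κ := by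
    intro D
    have h := hlim.mul_const D
    rw [zero_mul] at h
    exact (h.eventually (gt_mem_nhds hκ)).mono fun _ => le_of_lt
  have h16 : ∀ᶠ c : ℝ in 𝓝[>] 0, c ≤ 1 / 16 :=
    nhdsWithin_le_nhds (ge_mem_nhds (by norm_num))
  obtain ⟨c, h1, h2, h3, h4⟩ :=
    ((hsmall A).and ((hsmall B).and (h16.and self_mem_nhdsWithin))).exists
  exact ⟨c, h4, h3, h1, h2⟩

/-- Half of the decay in `b` is given up for decay in `s`, using b ≥ s - 1. -/
lemma two_rpow_le_of_le_add_one {γ b s : ℝ} (hγ : 0 < γ) (hb : 0 ≤ b) (hs : s ≤ b + 1) :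
    (2 : ℝ) ^ (-b * γ) ≤ 2 ^ (γ / 2) * (2 ^ (-(γ / 2) * |b - 0|) * 2 ^ (-(γ / 2) * s)) := by
  rw [← Real.rpow_add two_pos, ← Real.rpow_add two_pos, sub_zero, abs_of_nonneg hb]
  refine Real.rpow_le_rpow_of_exponent_le one_le_two ?_
  nlinarith

lemma two_rpow_le_of_mem_window {γ β ρ b s : ℝ} (hγ : 0 < γ) (hβ : 0 < β) (hρ : 0 < ρ)
    (hs : 0 ≤ s) (h1 : ρ ≤ 2 ^ (s - b - 5)) (h2 : 2 ^ (s - b - 5) < ρ / β) :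
    (2 : ℝ) ^ (-b * γ) ≤ 2 ^ (5 * γ + γ / 2 * 3 * -Real.logb 2 β) * ρ ^ γ *
      (2 ^ (-(γ / 2) * |b - (-Real.logb 2 ρ - 5)|) * 2 ^ (-(γ / 2) * s)) := by
  obtain ⟨L, hL⟩ : ∃ L, L = Real.logb 2 ρ := ⟨_, rfl⟩
  obtain ⟨l, hl⟩ : ∃ l, l = Real.logb 2 β := ⟨_, rfl⟩
  have hρL : ρ = 2 ^ L := by rw [hL, Real.rpow_logb two_pos (by norm_num) hρ]
  have hβl : β = 2 ^ l := by rw [hl, Real.rpow_logb two_pos (by norm_num) hβ]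
  rw [← hL, ← hl, hρL, ← Real.rpow_mul zero_le_two, ← Real.rpow_add two_pos,
    ← Real.rpow_add two_pos, ← Real.rpow_add two_pos]
  rw [hρL, Real.rpow_le_rpow_left_iff one_lt_two] at h1
  rw [hρL, hβl, ← Real.rpow_sub two_pos, Real.rpow_lt_rpow_left_iff one_lt_two] at h2
  refine Real.rpow_le_rpow_of_exponent_le one_le_two ?_
  -- The window forces b + log₂ ρ + 5 to lie between s + log₂ β and s. So the decay 2^(-γs) can be
  -- split evenly between `s` and the distance of `b` from -log₂ ρ - 5.
  have h3 : |b - (-L - 5)| ≤ s - l := abs_le.mpr ⟨by linarith, by linarith⟩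
  nlinarith [mul_le_mul_of_nonneg_left h3 hγ.le, mul_le_mul_of_nonneg_left h2.le hγ.le]

end Weights

/-! ### Assembling the obstacles that cover the complement of the bad set -/

variable {K : Type*} [Field K] [NumberField K]

/-- The index set of the obstacles: the embeddings `σ`, `τ` and the dyadic scales `b`, `a`. -/
abbrev ObstacleIndex (r : (K →+* ℂ) → ℝ) : Type _ :=
  {i : ((K →+* ℂ) × {τ : K →+* ℂ // 0 < r τ}) × ℕ × ℕ //
    |2 * r i.1.2.1 * i.2.2 - i.2.1| ≤ (i.2.1 : ℝ) + 1}

lemma mem_bad_of_forall_notMem_obstacle {r : (K →+* ℂ) → ℝ} (hr : ∀ σ, 0 ≤ r σ)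
    (hr1 : ∑ σ, r σ = 1) {c : ℝ} (hc0 : 0 < c) (hc : c ≤ 1)
    {z : EuclideanSpace ℂ (K →+* ℂ)}
    (hz : ∀ i : ObstacleIndex r, z ∉ obstacle r c i.1.1.1 i.1.1.2.1 i.1.2.1 i.1.2.2) :
    z ∈ Bad K r := by
  have : Nonempty (𝓞 K × {q : 𝓞 K // q ≠ 0}) := ⟨(0, ⟨1, one_ne_zero⟩)⟩
  refine hc0.trans_le (le_ciInf fun pq => not_lt.mp fun hlt => ?_)
  obtain ⟨σ, τ, b, a, hτ, hs, hmem⟩ := exists_mem_obstacle hr hr1 hc pq.2.2 hlt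
  exact hz ⟨((σ, ⟨τ, hτ⟩), b, a), hs⟩ hmem

omit [NumberField K] in
lemma tsum_obstacleIndex_le {r : (K →+* ℂ) → ℝ} {γ C x c M : ℝ} {w : ObstacleIndex r → ℝ}
    (hw : ∀ i, w i = c * 2 ^ (-(i.1.2.1 : ℝ))) (hc : 0 < c) (hM : 0 ≤ M)
    (hC : ∑' i : ((K →+* ℂ) × {τ : K →+* ℂ // 0 < r τ}) × ℕ × ℕ, ENNReal.ofReal
      ((2 : ℝ) ^ (-(γ / 2) * |(i.2.1 : ℝ) - x|) *
        2 ^ (-(γ / 2) * |2 * r i.1.2.1 * i.2.2 - i.2.1|)) ≤ ENNReal.ofReal C)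
    {P : ObstacleIndex r → Prop} [DecidablePred P]
    (hP : ∀ i, P i → (2 : ℝ) ^ (-(i.1.2.1 : ℝ) * γ) ≤ M *
      ((2 : ℝ) ^ (-(γ / 2) * |(i.1.2.1 : ℝ) - x|) *
        2 ^ (-(γ / 2) * |2 * r i.1.1.2.1 * i.1.2.2 - i.1.2.1|))) :
    ∑' i, (if P i then ENNReal.ofReal (w i ^ γ) else 0) ≤ ENNReal.ofReal (c ^ γ * M * C) := by
  rw [ENNReal.ofReal_mul (by positivity)]
  refine le_trans ?_ (mul_le_mul_right hC _)
  rw [← ENNReal.tsum_mul_left]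
  refine le_trans (ENNReal.tsum_le_tsum fun i => ?_) (ENNReal.tsum_comp_le_tsum_of_injective
    (f := fun i : ObstacleIndex r => i.1) Subtype.val_injective _)
  split_ifs with hi
  · rw [← ENNReal.ofReal_mul (by positivity)]
    refine ENNReal.ofReal_le_ofReal ?_
    rw [hw, Real.mul_rpow hc.le (by positivity), ← Real.rpow_mul zero_le_two, mul_assoc]
    exact mul_le_mul_of_nonneg_left (hP i hi) (by positivity)
  · exact zero_le

end WeightedBad

end

theorem proposition1p2 {K : Type*} [Field K] [NumberField K] [NumberField.IsTotallyComplex K]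
    (r : (K →+* ℂ) → ℝ) (hr : ∀ σ, 0 ≤ r σ) (hr1 : ∑ σ, r σ = 1) :
    WeightedBad.IsHAW (WeightedBad.Bad K r) := by
  intro β hβ hβ'
  have hrle : ∀ σ, r σ ≤ 1 := fun σ =>
    hr1 ▸ Finset.single_le_sum (fun σ _ => hr σ) (Finset.mem_univ σ)
  obtain ⟨γ, κ, hγ, hκ, hwin⟩ := WeightedBad.exists_potential_criterion (K →+* ℂ) hβ hβ'
  refine hwin _ fun ρ₀ hρ₀ => ?_
  obtain ⟨C, hC0, hC⟩ := WeightedBad.exists_tsum_prod_two_rpow_le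
    (T := (K →+* ℂ) × {τ : K →+* ℂ // 0 < r τ}) (half_pos hγ)
    (s := fun t => 2 * r t.2.1) fun t => mul_pos two_pos t.2.2
  -- `A` serves the initial potential and `B` the new obstacles at each scale. The constant `c` may
  -- depend on the initial radius, because the criterion lets the obstacles depend on `ρ₀`.
  obtain ⟨c, hc0, hc, hinit, hwindow⟩ := WeightedBad.exists_small_constant
    (A := 2 ^ (γ / 2) * C / ρ₀ ^ γ) (B := 2 ^ (5 * γ + γ / 2 * 3 * -Real.logb 2 β) * C) hγ hκ
  refine ⟨WeightedBad.ObstacleIndex r,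
    fun i => WeightedBad.obstacle r c i.1.1.1 i.1.1.2.1 i.1.2.1 i.1.2.2,
    fun i => i.1.1.1, fun i => c * 2 ^ (-(i.1.2.1 : ℝ)),
    fun i => 2 ^ (|2 * r i.1.1.2.1 * i.1.2.2 - i.1.2.1| - i.1.2.1 - 5 : ℝ),
    fun i => by positivity, fun i => by positivity,
    fun z hz => WeightedBad.mem_bad_of_forall_notMem_obstacle hr hr1 hc0 (by linarith) hz,
    fun i B hB => WeightedBad.exists_center_of_obstacle hr hrle hc i.2 B hB, ?_, fun ρ hρ => ?_⟩
  · refine (WeightedBad.tsum_obstacleIndex_le (M := 2 ^ (γ / 2)) (fun _ => rfl) hc0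
      (by positivity) (hC 0) fun i _ => WeightedBad.two_rpow_le_of_le_add_one hγ (Nat.cast_nonneg _) i.2).trans
      (ENNReal.ofReal_le_ofReal ?_)
    rwa [← mul_div_assoc, div_le_iff₀ (by positivity), ← mul_assoc] at hinit
  · refine (WeightedBad.tsum_obstacleIndex_le (fun _ => rfl) hc0 (by positivity) (hC _) fun i hi =>
      WeightedBad.two_rpow_le_of_mem_window hγ hβ hρ (abs_nonneg _) hi.1 hi.2).trans
      (ENNReal.ofReal_le_ofReal ?_)
    have := mul_le_mul_of_nonneg_right hwindow (Real.rpow_pos_of_pos hρ γ).le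
    linarith
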